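/- Let $p\ge 3$ be a prime. For a finite group $G$ let $$\mathscr S(G)=\Big\{\det\big(a_{gh^{-1}}\big)_{g,h\in G} : a_g\in\mathbb Z \text{ for all } g\in G\Big\}$$ be the set of integer group determinants of $G$, and let $\mathscr S_1(G)$ be the set of elements of $\mathscr S(G)$ that are coprime to $p$. Let $$H_p=\left\{\begin{pmatrix}1&a&c\\0&1&b\\0&0&1\end{pmatrix} : a,b,c\in\mathbb Z/p\mathbb Z\right\}$$ be the Heisenberg group of order $p^3$, under matrix multiplication, and let $$\mathscr T_3=\{m\in\mathbb Z : m\equiv a^{p^2} \bmod p^3 \text{ for some integer } a \text{ with } 1\le a<p\}.$$ Then $$\mathscr S_1(H_p)=\mathscr T_3=\{x\in\mathbb Z : x^{p-1}\equiv 1 \bmod p^3\},$$ and also $\mathscr S_1\big((\mathbb Z/p\mathbb Z)^3\big)=\mathscr T_3$, so that $\mathscr S_1(H_p)=\mathscr S_1\big((\mathbb Z/p\mathbb Z)^3\big)$. -/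

import Mathlib

/-- The Heisenberg group `H(R)`: the upper triangular `3 × 3` matrices with ones on the diagonal,
under matrix multiplication, as a subgroup of `GL₃(R)`. -/
def heisenberg (R : Type*) [CommRing R] : Subgroup (GL (Fin 3) R) where
  carrier := {M | ∃ a b c : R, (M : Matrix (Fin 3) (Fin 3) R) = !![1, a, c; 0, 1, b; 0, 0, 1]}
  one_mem' := ⟨0, 0, 0, by
    ext i j
    fin_cases i <;> fin_cases j <;> simp⟩
  mul_mem' := by
    rintro M N ⟨a, b, c, hM⟩ ⟨a', b', c', hN⟩
    refine ⟨a + a', b + b', c + a * b' + c', ?_⟩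
    rw [Units.val_mul, hM, hN]
    ext i j
    fin_cases i <;> fin_cases j <;>
      simp [Matrix.mul_apply, Fin.sum_univ_three] <;> ring
  inv_mem' := by
    rintro M ⟨a, b, c, hM⟩
    refine ⟨-a, -b, a * b - c, ?_⟩
    refine Units.inv_eq_of_mul_eq_one_right ?_
    rw [hM]
    ext i j
    fin_cases i <;> fin_cases j <;>
      simp [Matrix.mul_apply, Fin.sum_univ_three] <;> ring

noncomputable instance heisenbergFintype (R : Type*) [CommRing R] [Finite R] :
    Fintype (heisenberg R) :=
  Fintype.ofFinite _

/-- The integer group determinant `det (a_{g h⁻¹})`, rows indexed by `g` and columns by `h`. -/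
def groupDet (G : Type*) [Group G] [Fintype G] [DecidableEq G] (a : G → ℤ) : ℤ :=
  (Matrix.of fun g h : G => a (g * h⁻¹)).det

/-- `𝒮(G)`: the values taken by the group determinant of `G` at integer variables. -/
def groupDetValues (G : Type*) [Group G] [Fintype G] [DecidableEq G] : Set ℤ :=
  {d | ∃ a : G → ℤ, groupDet G a = d}

/-- `𝒮₁(G)`: the integer group determinants of `G` that are coprime to `p`. -/
def coprimeGroupDetValues (p : ℕ) (G : Type*) [Group G] [Fintype G] [DecidableEq G] : Set ℤ :=
  {d | d ∈ groupDetValues G ∧ IsCoprime d (p : ℤ)}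

/-- `𝒯ₙ = {m ∈ ℤ : m ≡ a ^ (p ^ (n - 1)) mod p ^ n for some 1 ≤ a < p}`, for `n ≥ 1`. -/
def teichmullerSet (p n : ℕ) : Set ℤ :=
  {m | ∃ a : ℕ, 1 ≤ a ∧ a < p ∧ m ≡ (a : ℤ) ^ p ^ (n - 1) [ZMOD (p : ℤ) ^ n]}

/-!
The group determinant of `G` at `a` is the norm `N x` of `x = ∑ a_g g` in `ℤ[G]`.

Let `|G| = p ^ (n + 1)` and `g ^ p = 1` for all `g`. From
`N (1 - s g) = (1 - s ^ o) ^ (|G| / o)`, with `o` the order of `g`, the multiplicative functions `N`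
and `ε ^ |G|`, where `ε` is the augmentation, agree modulo `p ^ (n + 1)` on the elements `1 - s g`.
Such elements generate enough of the group algebra over any base ring to give
`N x ≡ ε x ^ |G| [ZMOD p ^ (n + 1)]` for all `x`, so the values of `N` prime to `p` are
`p ^ n`-th powers modulo `p ^ (n + 1)`.

Conversely, for `π : G → Q` onto and `π* w = ∑ w_{π g} g` one has
`N (y + π* w) * N (π y) = N y * N (π y + |ker π| w)`. For `Q = 1` this shows that a nonzero
integer which is both the norm and the augmentation of an element can be changed by any multiple of
`|G|`. For `ker π` of order `p` and `Q` elementary abelian it turns an element of `ℤ[Q]` with norm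
and augmentation `e` prime to `p` into one of `ℤ[G]` with norm and augmentation `e ^ p`; iterating,
`a ^ p ^ (n + 1)` is such an integer for all `a` prime to `p`.
-/

open scoped MonoidAlgebra

namespace GroupDeterminant

variable {R S G Q A : Type*} [CommRing R] [CommRing S] [Group G] [Group Q] [CommGroup A]

section GroupMatrix

/-- The group matrix `(x_{g h⁻¹})_{g, h}` of an element `x = ∑ x_g g` of the group algebra. -/
def groupMatrix (x : R[G]) : Matrix G G R :=
  .of fun g h => x.coeff (g * h⁻¹)

@[simp]
theorem groupMatrix_apply (x : R[G]) (g h : G) : groupMatrix x g h = x.coeff (g * h⁻¹) := rfl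

theorem groupMatrix_add (x y : R[G]) : groupMatrix (x + y) = groupMatrix x + groupMatrix y := by
  ext; simp

theorem groupMatrix_smul (r : R) (x : R[G]) : groupMatrix (r • x) = r • groupMatrix x := by
  ext; simp

theorem leftMulMatrix_basis [Fintype G] [DecidableEq G] (x : R[G]) :
    Algebra.leftMulMatrix (MonoidAlgebra.basis G R) x = groupMatrix x := by
  ext g h
  simp [Algebra.leftMulMatrix_eq_repr_mul, MonoidAlgebra.basis]

theorem norm_eq_det_groupMatrix [Fintype G] [DecidableEq G] (x : R[G]) :
    Algebra.norm R x = (groupMatrix x).det := by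
  rw [Algebra.norm_eq_matrix_det (MonoidAlgebra.basis G R), leftMulMatrix_basis]

theorem norm_mapRingHom [Finite G] (f : R →+* S) (x : R[G]) :
    Algebra.norm S (MonoidAlgebra.mapRingHom G f x) = f (Algebra.norm R x) := by
  classical
  have := Fintype.ofFinite G
  rw [norm_eq_det_groupMatrix, norm_eq_det_groupMatrix, RingHom.map_det]
  rfl

theorem norm_algebraMap [Finite G] (r : R) :
    Algebra.norm R (algebraMap R R[G] r) = r ^ Nat.card G := by
  have := Fintype.ofFinite G
  rw [Algebra.norm_algebraMap_of_basis (MonoidAlgebra.basis G R), Nat.card_eq_fintype_card]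

theorem groupDet_coeff [Fintype G] [DecidableEq G] (x : ℤ[G]) :
    groupDet G x.coeff = Algebra.norm ℤ x :=
  (norm_eq_det_groupMatrix x).symm

theorem mem_groupDetValues_iff [Fintype G] [DecidableEq G] {d : ℤ} :
    d ∈ groupDetValues G ↔ ∃ x : ℤ[G], Algebra.norm ℤ x = d := by
  constructor
  · rintro ⟨a, rfl⟩
    exact ⟨.ofCoeff (Finsupp.equivFunOnFinite.symm a), (groupDet_coeff _).symm⟩
  · rintro ⟨x, rfl⟩
    exact ⟨x.coeff, groupDet_coeff x⟩

theorem mapRingHom_smul (f : R →+* S) (r : R) (x : R[G]) :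
    MonoidAlgebra.mapRingHom G f (r • x) = f r • MonoidAlgebra.mapRingHom G f x := by
  ext g
  simp

end GroupMatrix

section Subgroup

theorem coeff_mapDomain_subtype {H : Subgroup G} (y : R[H]) (h : H) :
    (MonoidAlgebra.mapDomainRingHom R H.subtype y).coeff h = y.coeff h :=
  Finsupp.mapDomain_apply H.subtype_injective y.coeff h

theorem coeff_mapDomain_subtype_of_notMem {H : Subgroup G} (y : R[H]) {g : G} (hg : g ∉ H) :
    (MonoidAlgebra.mapDomainRingHom R H.subtype y).coeff g = 0 := by
  simpa using Finsupp.mapDomain_of_notMem_range (f := H.subtype) y.coeff g (by simpa using hg)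

theorem norm_mapDomain_subtype [Finite G] (H : Subgroup G) (y : R[H]) :
    Algebra.norm R (MonoidAlgebra.mapDomainRingHom R H.subtype y) =
      Algebra.norm R y ^ H.index := by
  classical
  have := Fintype.ofFinite G
  obtain ⟨T, hT, -⟩ := H.exists_isComplement_right 1
  let e : G ≃ H × T := hT.equiv
  have he (a : H × T) : e.symm a = a.1 * a.2 := hT.equiv_symm_apply a
  have hblock : (groupMatrix (MonoidAlgebra.mapDomainRingHom R H.subtype y)).submatrix
      e.symm e.symm = Matrix.blockDiagonal fun _ : T => groupMatrix y := by
    ext ⟨h, t⟩ ⟨h', t'⟩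
    rw [Matrix.submatrix_apply, groupMatrix_apply, Matrix.blockDiagonal_apply, he, he]
    split_ifs with ht
    · obtain rfl : t = t' := ht
      simpa [mul_assoc] using coeff_mapDomain_subtype y (h * h'⁻¹)
    · refine coeff_mapDomain_subtype_of_notMem y fun hmem => ht ?_
      have hcoset := hT.equiv_snd_eq_iff_rightCosetEquivalence.2 ((rightCoset_eq_iff H).2 hmem)
      rw [← he (h, t), ← he (h', t')] at hcoset
      simpa [e] using hcoset.symm
  rw [norm_eq_det_groupMatrix, norm_eq_det_groupMatrix, ← Matrix.det_submatrix_equiv_self e.symm,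
    hblock, Matrix.det_blockDiagonal, Finset.prod_const, Finset.card_univ,
    ← Nat.card_eq_fintype_card, hT.card_right]

end Subgroup

section Pullback

/-- The incidence matrix of a map of groups: the matrix of `R[G] → R[Q]` in the standard bases,
transposed. -/
def fiberMatrix (R : Type*) [CommRing R] [DecidableEq Q] (π : G →* Q) : Matrix G Q R :=
  .of fun g q => if π g = q then 1 else 0

/-- The pullback `∑ w_{π g} g` of `w = ∑ w_q q` along a homomorphism `π` from a finite group. -/
noncomputable def pullback [Finite G] (π : G →* Q) (w : R[Q]) : R[G] :=
  .ofCoeff (Finsupp.equivFunOnFinite.symm fun g => w.coeff (π g))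

@[simp]
theorem coeff_pullback [Finite G] (π : G →* Q) (w : R[Q]) (g : G) :
    (pullback π w).coeff g = w.coeff (π g) := rfl

theorem card_fiber [Fintype G] [DecidableEq Q] {π : G →* Q} (hπ : Function.Surjective π) (q : Q) :
    Finset.card {g | π g = q} = Nat.card π.ker := by
  rw [MonoidHom.card_fiber_eq_of_mem_range π (hπ q) ⟨1, map_one π⟩, Nat.card_eq_fintype_card,
    Fintype.card_subtype]
  simp only [MonoidHom.mem_ker]

theorem coeff_mapDomainRingHom [Fintype G] [DecidableEq Q] (π : G →* Q) (y : R[G]) (q : Q) :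
    (MonoidAlgebra.mapDomainRingHom R π y).coeff q = ∑ g, if π g = q then y.coeff g else 0 := by
  simp [Finsupp.mapDomain, Finsupp.sum_fintype, Finsupp.single_apply]

theorem groupMatrix_pullback [Finite G] [Fintype Q] [DecidableEq Q] (π : G →* Q) (w : R[Q]) :
    groupMatrix (pullback π w) =
      fiberMatrix R π * groupMatrix w * (fiberMatrix R π).transpose := by
  ext g h
  simp [Matrix.mul_apply, fiberMatrix]

theorem groupMatrix_mul_fiberMatrix [Fintype G] [Fintype Q] [DecidableEq Q] (π : G →* Q)
    (y : R[G]) :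
    groupMatrix y * fiberMatrix R π =
      fiberMatrix R π * groupMatrix (MonoidAlgebra.mapDomainRingHom R π y) := by
  ext g q
  trans ∑ h, if π h = q then y.coeff (g / h) else 0
  · simp [Matrix.mul_apply, fiberMatrix, div_eq_mul_inv]
  · rw [Matrix.mul_apply, Finset.sum_eq_single (π g)]
    · simp only [fiberMatrix, Matrix.of_apply, if_true, one_mul, groupMatrix_apply,
        coeff_mapDomainRingHom]
      refine Fintype.sum_equiv (Equiv.divLeft g) _ _ fun h => ?_
      simp [div_eq_mul_inv]
    · intro q' _ hq'
      simp [fiberMatrix, hq'.symm]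
    · simp

theorem fiberMatrix_transpose_mul_self [Fintype G] [DecidableEq Q] {π : G →* Q}
    (hπ : Function.Surjective π) :
    (fiberMatrix R π).transpose * fiberMatrix R π = (Nat.card π.ker : R) • 1 := by
  ext q q'
  obtain rfl | hq := eq_or_ne q q'
  · rw [← card_fiber hπ q]
    simp [Matrix.mul_apply, fiberMatrix, ← ite_and]
  · have hempty (g : G) : ¬(π g = q' ∧ π g = q) := fun h => hq (h.2.symm.trans h.1)
    simp [Matrix.mul_apply, fiberMatrix, hq, ← ite_and, hempty]

theorem norm_add_pullback_mul [Finite G] [Finite Q] {π : G →* Q}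
    (hπ : Function.Surjective π) (y : R[G]) (w : R[Q]) :
    Algebra.norm R (y + pullback π w) *
        Algebra.norm R (MonoidAlgebra.mapDomainRingHom R π y) =
      Algebra.norm R y *
        Algebra.norm R (MonoidAlgebra.mapDomainRingHom R π y + (Nat.card π.ker : R) • w) := by
  classical
  have := Fintype.ofFinite G
  have := Fintype.ofFinite Q
  simp only [norm_eq_det_groupMatrix, groupMatrix_add, groupMatrix_smul, groupMatrix_pullback]
  have hUP := groupMatrix_mul_fiberMatrix π y
  have hPP := fiberMatrix_transpose_mul_self (R := R) hπ
  set U := groupMatrix y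
  set B := groupMatrix (MonoidAlgebra.mapDomainRingHom R π y)
  set W := groupMatrix w
  set P := fiberMatrix R π
  have hblock : Matrix.fromBlocks U (-P) (W * P.transpose) 1 * Matrix.fromBlocks 1 P 0 B =
      Matrix.fromBlocks U 0 (W * P.transpose) (B + (Nat.card π.ker : R) • W) := by
    rw [Matrix.fromBlocks_multiply, hUP]
    simp [Matrix.mul_assoc, hPP, add_comm]
  have hdet := congrArg Matrix.det hblock
  rw [Matrix.det_mul, Matrix.det_fromBlocks_one₂₂, Matrix.det_fromBlocks_zero₂₁,
    Matrix.det_fromBlocks_zero₁₂, Matrix.det_one, one_mul] at hdet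
  simpa [Matrix.mul_assoc] using hdet

end Pullback

section ExactFormula

open Polynomial

theorem eq_zero_of_aeval_single_eq_zero {z : G} {q : R[X]} (hdeg : q.natDegree < orderOf z)
    (hq : aeval (MonoidAlgebra.single z (1 : R)) q = 0) : q = 0 := by
  ext j
  by_cases hj : j < orderOf z
  · have hcoeff := congrArg (fun x : R[G] => x.coeff (z ^ j)) hq
    simp only [aeval_eq_sum_range' hdeg, MonoidAlgebra.single_pow, one_pow] at hcoeff
    rw [MonoidAlgebra.coeff_sum, Finsupp.finsetSum_apply, Finset.sum_eq_single j] at hcoeff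
    · simpa using hcoeff
    · intro i hi hij
      have hne : z ^ i ≠ z ^ j := fun h =>
        hij (pow_injOn_Iio_orderOf (Finset.mem_range.1 hi) hj h)
      simp [hne]
    · simp [hj]
  · rw [coeff_eq_zero_of_natDegree_lt (by omega), coeff_zero]

theorem charpoly_leftMulMatrix_single [Fintype G] [DecidableEq G] {z : G}
    (hz : orderOf z = Nat.card G) :
    (Algebra.leftMulMatrix (MonoidAlgebra.basis G R) (MonoidAlgebra.single z 1)).charpoly =
      X ^ Nat.card G - 1 := by
  nontriviality R
  set M := Algebra.leftMulMatrix (MonoidAlgebra.basis G R) (MonoidAlgebra.single z 1)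
  have hmonic : (X ^ Nat.card G - 1 : R[X]).Monic := monic_X_pow_sub_C 1 Nat.card_pos.ne'
  have hdegree : M.charpoly.degree = (X ^ Nat.card G - 1 : R[X]).degree := by
    rw [M.charpoly_degree_eq_dim, ← C_1, degree_X_pow_sub_C Nat.card_pos, Nat.card_eq_fintype_card]
  rw [← sub_eq_zero]
  have hlt := degree_sub_lt_left hdegree M.charpoly_monic.ne_zero (by rw [M.charpoly_monic, hmonic])
  refine eq_zero_of_aeval_single_eq_zero (z := z) ?_ ?_
  · rw [hz]
    rw [M.charpoly_degree_eq_dim, ← Nat.card_eq_fintype_card] at hlt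
    by_cases h0 : M.charpoly - (X ^ Nat.card G - 1) = 0
    · rw [h0, natDegree_zero]
      exact Nat.card_pos
    · exact (natDegree_lt_iff_degree_lt h0).2 hlt
  · have hroot : aeval (MonoidAlgebra.single z (1 : R)) M.charpoly = 0 := by
      apply Algebra.leftMulMatrix_injective (MonoidAlgebra.basis G R)
      rw [← aeval_algHom_apply, M.aeval_self_charpoly, map_zero]
    rw [map_sub, hroot]
    simp [MonoidAlgebra.single_pow, MonoidAlgebra.one_def]

theorem norm_algebraMap_sub_single [Finite G] {z : G} (hz : orderOf z = Nat.card G) (s : R) :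
    Algebra.norm R (algebraMap R R[G] s - MonoidAlgebra.single z 1) = s ^ Nat.card G - 1 := by
  classical
  have := Fintype.ofFinite G
  have heval := Matrix.eval_charpoly
    (Algebra.leftMulMatrix (MonoidAlgebra.basis G R) (MonoidAlgebra.single z 1)) s
  rw [charpoly_leftMulMatrix_single hz] at heval
  rw [Algebra.norm_eq_matrix_det (MonoidAlgebra.basis G R), map_sub, AlgHom.commutes]
  exact heval.symm.trans (by simp)

theorem norm_one_sub_single_of_orderOf_eq_card [Finite G] {z : G} (hz : orderOf z = Nat.card G)
    (s : R) : Algebra.norm R (1 - MonoidAlgebra.single z s) = 1 - s ^ Nat.card G := by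
  have hfactor : (1 - MonoidAlgebra.single z s : R[G]) =
      (algebraMap R R[G] 0 - MonoidAlgebra.single z 1) *
        (algebraMap R R[G] s - MonoidAlgebra.single z⁻¹ 1) := by
    simp [mul_sub, MonoidAlgebra.one_def]
    abel
  rw [hfactor, map_mul, norm_algebraMap_sub_single hz,
    norm_algebraMap_sub_single (by rwa [orderOf_inv]), zero_pow Nat.card_pos.ne']
  ring

theorem norm_one_sub_single [Finite G] (g : G) (s : R) :
    Algebra.norm R (1 - MonoidAlgebra.single g s) =
      (1 - s ^ orderOf g) ^ (Subgroup.zpowers g).index := by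
  let z : Subgroup.zpowers g := ⟨g, Subgroup.mem_zpowers g⟩
  have hz : orderOf z = Nat.card (Subgroup.zpowers g) := by
    rw [Nat.card_zpowers, ← Subgroup.orderOf_coe]
  have hmap : MonoidAlgebra.mapDomainRingHom R (Subgroup.zpowers g).subtype
      (1 - MonoidAlgebra.single z s) = 1 - MonoidAlgebra.single g s := by
    rw [map_sub, map_one]
    simp [z]
  rw [← hmap, norm_mapDomain_subtype, norm_one_sub_single_of_orderOf_eq_card hz, Nat.card_zpowers]

theorem zpowers_pow_of_coprime [Finite G] {g : G} {a : ℕ} (ha : (orderOf g).Coprime a) :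
    Subgroup.zpowers (g ^ a) = Subgroup.zpowers g := by
  refine Subgroup.eq_of_le_of_card_ge (Subgroup.zpowers_le_of_mem ?_) ?_
  · exact Subgroup.npow_mem_zpowers g a
  · rw [Nat.card_zpowers, Nat.card_zpowers, ha.orderOf_pow]

theorem norm_geom_sum_single_of_pow_ne_one [Finite G] [IsDomain R] {g : G} {a : ℕ}
    (ha : (orderOf g).Coprime a) {s : R} (hs : s ^ orderOf g ≠ 1) :
    Algebra.norm R (∑ i ∈ Finset.range a, MonoidAlgebra.single g s ^ i) =
      (∑ i ∈ Finset.range a, (s ^ orderOf g) ^ i) ^ (Subgroup.zpowers g).index := by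
  have hgeom := congrArg (Algebra.norm R) (mul_neg_geom_sum (MonoidAlgebra.single g s) a)
  rw [map_mul, MonoidAlgebra.single_pow, norm_one_sub_single, norm_one_sub_single,
    ha.orderOf_pow, zpowers_pow_of_coprime ha, ← pow_mul, mul_comm a, pow_mul,
    ← mul_neg_geom_sum (s ^ orderOf g), mul_pow] at hgeom
  exact mul_left_cancel₀ (pow_ne_zero _ (sub_ne_zero.2 hs.symm)) hgeom

theorem norm_geom_sum_single [Finite G] {g : G} {a : ℕ} (ha : (orderOf g).Coprime a) :
    Algebra.norm R (∑ i ∈ Finset.range a, MonoidAlgebra.single g (1 : R) ^ i) =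
      (a : R) ^ (Subgroup.zpowers g).index := by
  let φ : ℤ[X] →+* R := eval₂RingHom (Int.castRingHom R) 1
  have hφ : φ X = 1 := eval₂_X _ _
  have hX : (X ^ orderOf g : ℤ[X]) ≠ 1 := fun h =>
    X_pow_sub_C_ne_zero (orderOf_pos g) (1 : ℤ) (by rw [h, C_1, sub_self])
  have hspec := congrArg φ (norm_geom_sum_single_of_pow_ne_one ha hX)
  rw [← norm_mapRingHom] at hspec
  simpa [hφ] using hspec

end ExactFormula

section Augmentation

/-- The augmentation `∑ x_g g ↦ ∑ x_g` of the group algebra. -/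
noncomputable def augmentation : R[G] →ₐ[R] R :=
  MonoidAlgebra.lift R R G 1

@[simp]
theorem augmentation_single (g : G) (r : R) : augmentation (MonoidAlgebra.single g r) = r := by
  simp [augmentation]

theorem augmentation_mapRingHom (f : R →+* S) (x : R[G]) :
    augmentation (MonoidAlgebra.mapRingHom G f x) = f (augmentation x) := by
  induction x using MonoidAlgebra.induction_linear with
  | zero => simp
  | add x y hx hy => simp only [map_add, hx, hy]
  | single g r => simp

theorem augmentation_mapDomainRingHom (π : G →* Q) (x : R[G]) :
    augmentation (MonoidAlgebra.mapDomainRingHom R π x) = augmentation x := by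
  induction x using MonoidAlgebra.induction_linear with
  | zero => simp
  | add x y hx hy => simp only [map_add, hx, hy]
  | single g r => simp

theorem augmentation_eq_sum [Fintype G] (x : R[G]) : augmentation x = ∑ g, x.coeff g := by
  simp [augmentation, MonoidAlgebra.lift_apply, Finsupp.sum_fintype]

theorem augmentation_pullback [Finite G] [Finite Q] {π : G →* Q} (hπ : Function.Surjective π)
    (w : R[Q]) : augmentation (pullback π w) = Nat.card π.ker * augmentation w := by
  classical
  have := Fintype.ofFinite G
  have := Fintype.ofFinite Q
  simp only [augmentation_eq_sum, coeff_pullback, Finset.mul_sum]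
  rw [← Finset.sum_fiberwise Finset.univ π]
  refine Finset.sum_congr rfl fun q _ => ?_
  rw [Finset.sum_congr rfl fun g hg => congrArg w.coeff (Finset.mem_filter.1 hg).2,
    Finset.sum_const, card_fiber hπ, nsmul_eq_mul]

theorem norm_of_subsingleton [Subsingleton G] (x : R[G]) :
    Algebra.norm R x = augmentation x := by
  let : Unique G := ⟨⟨1⟩, fun _ => Subsingleton.elim _ _⟩
  classical
  rw [norm_eq_det_groupMatrix, Matrix.det_unique, augmentation_eq_sum, Fintype.sum_unique]
  simp [Subsingleton.elim _ (1 : G)]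

end Augmentation

section NormCongruence

open Polynomial

theorem exists_one_sub_smul_add_mem_eqLocusM {M : Type*} [Monoid M] {φ ψ : R[G] →* M}
    (h : ∀ g s, φ (1 - MonoidAlgebra.single g s) = ψ (1 - MonoidAlgebra.single g s))
    (t : R) (x : R[G]) : ∃ w : R[G], 1 - t • x + t ^ 2 • w ∈ φ.eqLocusM ψ := by
  induction x using MonoidAlgebra.induction_linear with
  | zero => exact ⟨0, by simp [one_mem]⟩
  | single g r => exact ⟨0, by simpa using h g (t * r)⟩
  | add x y hx hy =>
    obtain ⟨v, hv⟩ := hx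
    obtain ⟨w, hw⟩ := hy
    refine ⟨v + w + x * y - t • (x * w + v * y) + t ^ 2 • (v * w), ?_⟩
    convert mul_mem hv hw using 1
    simp only [add_mul, sub_mul, mul_add, mul_sub, smul_mul_assoc, mul_smul_comm, one_mul, mul_one]
    module

/-- If `t` is nilpotent, the factors `1 - s g` generate the unit group `1 + t R[G]`: multiplying
`1 + t x` by suitable ones improves it to an element of `1 + t² R[G]`. -/
theorem map_one_add_smul_eq_of_isNilpotent {M : Type*} [Monoid M] {φ ψ : R[G] →* M}
    (h : ∀ g s, φ (1 - MonoidAlgebra.single g s) = ψ (1 - MonoidAlgebra.single g s))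
    {t : R} (ht : IsNilpotent t) (x : R[G]) : φ (1 + t • x) = ψ (1 + t • x) := by
  obtain ⟨n, hn⟩ := ht
  replace hn : t ^ 2 ^ n = 0 := pow_eq_zero_of_le Nat.lt_two_pow_self.le hn
  induction n generalizing t x with
  | zero => simp [show t = 0 by simpa using hn]
  | succ n ih =>
    obtain ⟨w, hw⟩ := exists_one_sub_smul_add_mem_eqLocusM h t x
    set u := 1 - t • x + t ^ 2 • w with hu
    have hunit : IsUnit u := by
      have hnil : IsNilpotent (t • (x - t • w)) :=
        ⟨2 ^ (n + 1), by rw [_root_.smul_pow, hn, zero_smul]⟩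
      convert hnil.isUnit_one_sub using 1
      rw [hu, smul_sub, smul_smul, sq]
      abel
    have hmul : u * (1 + t • x) = 1 + t ^ 2 • (w - x * x + t • (w * x)) := by
      simp only [hu, add_mul, sub_mul, mul_add, smul_mul_assoc, mul_smul_comm, one_mul,
        mul_one]
      module
    have heq := ih (t := t ^ 2) (w - x * x + t • (w * x)) (by rw [← pow_mul, ← pow_succ', hn])
    rw [← hmul, map_mul, map_mul, hw] at heq
    exact (hunit.map ψ).mul_left_cancel heq

variable {p n k : ℕ} [Fact p.Prime]

theorem prime_pow_dvd_norm_one_sub_single_sub [Finite G] (hG : Nat.card G = p ^ (n + k))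
    {g : G} (hg : g ^ p ^ k = 1) (s : R) :
    (p : R) ^ (n + 1) ∣
      Algebra.norm R (1 - MonoidAlgebra.single g s) - (1 - s) ^ p ^ (n + k) := by
  have hp := Fact.out (p := p.Prime)
  obtain ⟨j, hjk, hj⟩ := (Nat.dvd_prime_pow hp).1 (orderOf_dvd_of_pow_eq_one hg)
  obtain ⟨i, rfl⟩ := Nat.exists_eq_add_of_le hjk
  have hindex : (Subgroup.zpowers g).index = p ^ (n + i) := by
    have hcard := (Subgroup.zpowers g).card_mul_index
    rw [Nat.card_zpowers, hj, hG, add_left_comm, pow_add p j] at hcard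
    exact Nat.eq_of_mul_eq_mul_left (pow_pos hp.pos j) hcard
  have hbase : (p : R) ∣ (1 - s ^ p ^ j) - (1 - s) ^ p ^ j := by
    obtain ⟨r, hr⟩ := exists_add_pow_prime_pow_eq hp (1 - s) s j
    rw [sub_add_cancel, one_pow] at hr
    exact ⟨(1 - s) * s * r, by linear_combination hr⟩
  rw [norm_one_sub_single, hj, hindex, add_left_comm, pow_add p j, pow_mul]
  exact (pow_dvd_pow _ (by omega)).trans (dvd_sub_pow_of_dvd_sub hbase (n + i))

theorem norm_one_add_smul_of_isNilpotent [Finite G] (hG : Nat.card G = p ^ (n + k))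
    (hexp : ∀ g : G, g ^ p ^ k = 1) (hR : (p : R) ^ (n + 1) = 0) {t : R} (ht : IsNilpotent t)
    (x : R[G]) :
    Algebra.norm R (1 + t • x) = augmentation (1 + t • x) ^ p ^ (n + k) := by
  let ψ : R[G] →* R := (powMonoidHom (p ^ (n + k))).comp (augmentation : R[G] →ₐ[R] R)
  refine map_one_add_smul_eq_of_isNilpotent (φ := Algebra.norm R) (ψ := ψ) (fun g s => ?_) ht x
  have hdvd := prime_pow_dvd_norm_one_sub_single_sub hG (hexp g) s
  rw [hR, zero_dvd_iff, sub_eq_zero] at hdvd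
  simpa [ψ] using hdvd

theorem pow_dvd_norm_one_add_smul_sub [Finite G] (hG : Nat.card G = p ^ (n + k))
    (hexp : ∀ g : G, g ^ p ^ k = 1) (hR : (p : R) ^ (n + 1) = 0) (t : R) (x : R[G]) (m : ℕ) :
    t ^ m ∣ Algebra.norm R (1 + t • x) - augmentation (1 + t • x) ^ p ^ (n + k) := by
  let φ := Ideal.Quotient.mk (Ideal.span {t ^ m})
  have hker (r : R) : φ r = 0 ↔ t ^ m ∣ r := by
    rw [Ideal.Quotient.eq_zero_iff_mem, Ideal.mem_span_singleton]
  have hnil : IsNilpotent (φ t) := ⟨m, by rw [← map_pow, hker]⟩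
  have hRφ : (p : R ⧸ Ideal.span {t ^ m}) ^ (n + 1) = 0 := by
    simpa using congrArg φ hR
  have hmap : MonoidAlgebra.mapRingHom G φ (1 + t • x) =
      1 + φ t • MonoidAlgebra.mapRingHom G φ x := by
    rw [map_add, map_one, mapRingHom_smul]
  rw [← hker, map_sub, map_pow, ← norm_mapRingHom, ← augmentation_mapRingHom, hmap,
    norm_one_add_smul_of_isNilpotent hG hexp hRφ hnil, sub_self]

/-- Over `R[X]` the identity holds for `1 + X (x - 1)` modulo every power of `X`, hence exactly;
specialising to `X = 1` gives it for `x`. -/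
theorem norm_eq_augmentation_pow [Finite G] (hG : Nat.card G = p ^ (n + k))
    (hexp : ∀ g : G, g ^ p ^ k = 1) (hR : (p : R) ^ (n + 1) = 0) (x : R[G]) :
    Algebra.norm R x = augmentation x ^ p ^ (n + k) := by
  let y : R[X][G] := 1 + (X : R[X]) • (MonoidAlgebra.mapRingHom G C x - 1)
  have hR' : (p : R[X]) ^ (n + 1) = 0 := by
    simpa using congrArg C hR
  have hy : Algebra.norm R[X] y = augmentation y ^ p ^ (n + k) := by
    rw [← sub_eq_zero]
    ext i
    exact X_pow_dvd_iff.1 (pow_dvd_norm_one_add_smul_sub hG hexp hR' X _ (i + 1)) i i.lt_succ_self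
  have heval : MonoidAlgebra.mapRingHom G (evalRingHom 1) y = x := by
    ext g
    simp [y, mapRingHom_smul]
  have hspec := congrArg (evalRingHom 1) hy
  rwa [map_pow, ← norm_mapRingHom, ← augmentation_mapRingHom, heval] at hspec

theorem norm_modEq_augmentation_pow [Finite G] (hG : Nat.card G = p ^ (n + k))
    (hexp : ∀ g : G, g ^ p ^ k = 1) (x : ℤ[G]) :
    Algebra.norm ℤ x ≡ augmentation x ^ p ^ (n + k) [ZMOD (p : ℤ) ^ (n + 1)] := by
  have hzero : (p : ZMod (p ^ (n + 1))) ^ (n + 1) = 0 := by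
    rw [← Nat.cast_pow, ZMod.natCast_self]
  have h := norm_eq_augmentation_pow hG hexp hzero
    (MonoidAlgebra.mapRingHom G (Int.castRingHom _) x)
  rw [norm_mapRingHom, augmentation_mapRingHom, ← map_pow] at h
  exact_mod_cast (ZMod.intCast_eq_intCast_iff _ _ _).1 h

end NormCongruence

section NormAugmentationValues

/-- The integers that are simultaneously the norm and the augmentation of some element of `ℤ[G]`.
Controlling both makes the set accessible to induction along quotients of `G`. -/
def normAugmentationValues (G : Type*) [Group G] : Set ℤ :=
  {m | ∃ x : ℤ[G], Algebra.norm ℤ x = m ∧ augmentation x = m}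

theorem mem_normAugmentationValues_of_subsingleton [Subsingleton G] (m : ℤ) :
    m ∈ normAugmentationValues G :=
  ⟨MonoidAlgebra.single 1 m, by rw [norm_of_subsingleton, augmentation_single],
    augmentation_single 1 m⟩

theorem mem_normAugmentationValues_of_modEq [Finite G] {e m : ℤ}
    (he : e ∈ normAugmentationValues G) (he0 : e ≠ 0) (hm : m ≡ e [ZMOD Nat.card G]) :
    m ∈ normAugmentationValues G := by
  obtain ⟨x, hnorm, haug⟩ := he
  obtain ⟨k, hk⟩ := hm.symm.dvd
  obtain rfl : m = e + Nat.card G * k := by linarith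
  let π : G →* Unit := 1
  have hπ : Function.Surjective π := fun _ => ⟨1, rfl⟩
  have hker : Nat.card π.ker = Nat.card G := by
    rw [MonoidHom.ker_one, Subgroup.card_top]
  let w : ℤ[Unit] := MonoidAlgebra.single 1 k
  refine ⟨x + pullback π w, ?_, ?_⟩
  · have h := norm_add_pullback_mul hπ x w
    rw [norm_of_subsingleton (G := Unit), norm_of_subsingleton (G := Unit), map_add augmentation,
      augmentation_mapDomainRingHom, map_smul, augmentation_single, hker, hnorm, haug,
      mul_comm] at h
    exact mul_left_cancel₀ he0 h
  · rw [map_add, augmentation_pullback hπ, augmentation_single, hker, haug]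

variable {p : ℕ} [Fact p.Prime]

theorem card_ker_mul_card {π : G →* Q} (hπ : Function.Surjective π) :
    Nat.card π.ker * Nat.card Q = Nat.card G := by
  rw [← π.ker.card_mul_index, Subgroup.index_ker, MonoidHom.range_eq_top.2 hπ, Subgroup.card_top]

theorem index_zpowers_of_orderOf_eq_card_ker [Finite G] {π : G →* Q} (hπ : Function.Surjective π)
    {g : G} (hg : orderOf g = Nat.card π.ker) : (Subgroup.zpowers g).index = Nat.card Q := by
  have hcard := (Subgroup.zpowers g).card_mul_index
  rw [Nat.card_zpowers, hg, ← card_ker_mul_card hπ] at hcard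
  exact Nat.eq_of_mul_eq_mul_left Nat.card_pos hcard

theorem exists_pow_prime_eq_algebraMap_add_smul (hexp : ∀ g : A, g ^ p = 1) (x : R[A]) :
    ∃ w : R[A], x ^ p = algebraMap R R[A] (augmentation x ^ p) + (p : R) • w := by
  have hp := Fact.out (p := p.Prime)
  induction x using MonoidAlgebra.induction_linear with
  | zero => exact ⟨0, by simp [hp.ne_zero]⟩
  | single g r => exact ⟨0, by simp [MonoidAlgebra.single_pow, hexp]⟩
  | add x y hx hy =>
    obtain ⟨v, hv⟩ := hx
    obtain ⟨w, hw⟩ := hy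
    obtain ⟨r, hr⟩ := exists_add_pow_prime_eq hp x y
    obtain ⟨s, hs⟩ := exists_add_pow_prime_eq hp (augmentation x) (augmentation y)
    refine ⟨v + w + x * y * r - algebraMap R R[A] (augmentation x * augmentation y * s), ?_⟩
    rw [map_add, hr, hs, hv, hw]
    simp only [Algebra.smul_def, map_add, map_mul, map_natCast]
    ring

/-- If `x ^ p = e ^ p + p w` in `ℤ[A]` and `u = 1 + z + ⋯ + z ^ (e ^ p - 1)` with `z` generating
the kernel of `G → A`, then `u + π* w` lifts `x ^ p`, and it has norm and augmentation `e ^ p`. -/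
theorem pow_prime_mem_normAugmentationValues [Finite G] [Finite A] (hexp : ∀ c : A, c ^ p = 1)
    {π : G →* A} (hπ : Function.Surjective π) (hker : Nat.card π.ker = p) {e : ℕ}
    (hcop : p.Coprime e) (he : (e : ℤ) ∈ normAugmentationValues A) :
    (e : ℤ) ^ p ∈ normAugmentationValues G := by
  have hp := Fact.out (p := p.Prime)
  obtain ⟨x, hnorm, haug⟩ := he
  obtain ⟨w, hw⟩ := exists_pow_prime_eq_algebraMap_add_smul hexp x
  obtain ⟨z, hz⟩ := exists_prime_orderOf_dvd_card' p hker.symm.dvd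
  rw [← Subgroup.orderOf_coe] at hz
  let u : ℤ[G] := ∑ i ∈ Finset.range (e ^ p), MonoidAlgebra.single (z : G) 1 ^ i
  have hu : Algebra.norm ℤ u = ((e : ℤ) ^ p) ^ Nat.card A := by
    rw [norm_geom_sum_single (hz ▸ hcop.pow_right p),
      index_zpowers_of_orderOf_eq_card_ker hπ (hz.trans hker.symm), Nat.cast_pow]
  have hπu : MonoidAlgebra.mapDomainRingHom ℤ π u = algebraMap ℤ ℤ[A] (e ^ p) := by
    have hπz : π z = 1 := z.2
    simp [u, hπz, ← MonoidAlgebra.one_def]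
  have hlift : MonoidAlgebra.mapDomainRingHom ℤ π u + (Nat.card π.ker : ℤ) • w = x ^ p := by
    rw [hπu, hker, hw, haug]
  refine ⟨u + pullback π w, ?_, ?_⟩
  · have h := norm_add_pullback_mul hπ u w
    have hne : ((e : ℤ) ^ p) ^ Nat.card A ≠ 0 := by
      have he0 : e ≠ 0 := by
        rintro rfl
        exact hp.one_lt.ne' ((Nat.coprime_zero_right p).1 hcop)
      positivity
    rw [hlift, hπu, norm_algebraMap, hu, map_pow, hnorm, mul_comm] at h
    exact mul_left_cancel₀ hne h
  · rw [map_add, augmentation_pullback hπ, ← augmentation_mapDomainRingHom π, ← smul_eq_mul,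
      ← map_smul, ← map_add, hlift, map_pow, haug]

theorem pow_card_mem_normAugmentationValues [Finite A] (hexp : ∀ c : A, c ^ p = 1) {n : ℕ}
    (hcard : Nat.card A = p ^ n) {a : ℕ} (ha : p.Coprime a) :
    (a : ℤ) ^ p ^ n ∈ normAugmentationValues A := by
  induction n generalizing A with
  | zero =>
    have : Subsingleton A := Finite.card_le_one_iff_subsingleton.1 (by rw [hcard, pow_zero])
    exact mem_normAugmentationValues_of_subsingleton _
  | succ n ih =>
    obtain ⟨z, hz⟩ := exists_prime_orderOf_dvd_card' p (hcard ▸ dvd_pow_self p n.succ_ne_zero)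
    let H := Subgroup.zpowers z
    have hH : Nat.card H = p := by rw [Nat.card_zpowers, hz]
    have hquot : Nat.card (A ⧸ H) = p ^ n := by
      have hmul := H.card_eq_card_quotient_mul_card_subgroup
      rw [hcard, hH, pow_succ] at hmul
      exact (Nat.eq_of_mul_eq_mul_right (Fact.out (p := p.Prime)).pos hmul).symm
    have hexp' (c : A ⧸ H) : c ^ p = 1 := by
      obtain ⟨c, rfl⟩ := QuotientGroup.mk'_surjective H c
      rw [← map_pow, hexp, map_one]
    rw [pow_succ, pow_mul]
    exact_mod_cast pow_prime_mem_normAugmentationValues hexp' (QuotientGroup.mk'_surjective H)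
      (by rw [QuotientGroup.ker_mk', hH]) (ha.pow_right (p ^ n)) (by exact_mod_cast ih hexp' hquot)

end NormAugmentationValues

section Teichmuller

variable {p n : ℕ}

theorem pow_pow_modEq {x y : ℤ} (h : x ≡ y [ZMOD p]) (n : ℕ) :
    x ^ p ^ n ≡ y ^ p ^ n [ZMOD (p : ℤ) ^ (n + 1)] :=
  (Int.modEq_iff_dvd.2 (dvd_sub_pow_of_dvd_sub h.symm.dvd n)).symm

theorem isCoprime_iff_of_modEq {m x y : ℤ} (h : x ≡ y [ZMOD m]) :
    IsCoprime x m ↔ IsCoprime y m := by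
  obtain ⟨k, hk⟩ := h.dvd
  rw [eq_add_of_sub_eq' hk, IsCoprime.add_mul_left_left_iff]

variable [Fact p.Prime]

theorem exists_nat_modEq_of_isCoprime {x : ℤ} (hx : IsCoprime x p) :
    ∃ a : ℕ, 1 ≤ a ∧ a < p ∧ (a : ℤ) ≡ x [ZMOD p] := by
  refine ⟨(x : ZMod p).val, ?_, ZMod.val_lt _, ?_⟩
  · rw [Nat.one_le_iff_ne_zero, Ne, ZMod.val_eq_zero, ZMod.intCast_zmod_eq_zero_iff_dvd]
    intro h
    exact (Nat.prime_iff_prime_int.1 (Fact.out (p := p.Prime))).not_isUnit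
      (hx.isUnit_of_dvd' h dvd_rfl)
  · rw [← ZMod.intCast_eq_intCast_iff]
    simp

theorem mem_teichmullerSet_succ_iff {m : ℤ} :
    m ∈ teichmullerSet p (n + 1) ↔
      ∃ x : ℤ, IsCoprime x p ∧ m ≡ x ^ p ^ n [ZMOD (p : ℤ) ^ (n + 1)] := by
  constructor
  · rintro ⟨a, ha, hap, hm⟩
    refine ⟨a, Nat.isCoprime_iff_coprime.2 ?_, hm⟩
    exact (Nat.coprime_of_lt_prime (by omega) hap Fact.out).symm
  · rintro ⟨x, hx, hm⟩
    obtain ⟨a, ha, hap, hax⟩ := exists_nat_modEq_of_isCoprime hx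
    exact ⟨a, ha, hap, hm.trans (pow_pow_modEq hax n).symm⟩

theorem isCoprime_of_mem_teichmullerSet_succ {m : ℤ} (hm : m ∈ teichmullerSet p (n + 1)) :
    IsCoprime m p := by
  obtain ⟨x, hx, hmx⟩ := mem_teichmullerSet_succ_iff.1 hm
  exact (isCoprime_iff_of_modEq (hmx.of_dvd (dvd_pow_self _ n.succ_ne_zero))).2 hx.pow_left

theorem teichmullerSet_succ_eq :
    teichmullerSet p (n + 1) = {x : ℤ | x ^ (p - 1) ≡ 1 [ZMOD (p : ℤ) ^ (n + 1)]} := by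
  have hp := Fact.out (p := p.Prime)
  ext m
  rw [mem_teichmullerSet_succ_iff, Set.mem_ofPred_eq]
  constructor
  · rintro ⟨x, hx, hm⟩
    calc m ^ (p - 1) ≡ (x ^ p ^ n) ^ (p - 1) [ZMOD (p : ℤ) ^ (n + 1)] := hm.pow _
      _ = (x ^ (p - 1)) ^ p ^ n := pow_right_comm _ _ _
      _ ≡ 1 ^ p ^ n [ZMOD (p : ℤ) ^ (n + 1)] :=
        pow_pow_modEq (Int.ModEq.pow_card_sub_one_eq_one hp hx) n
      _ = 1 := one_pow _
  · intro hm
    have hcop : IsCoprime (m ^ (p - 1)) p :=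
      (isCoprime_iff_of_modEq (hm.of_dvd (dvd_pow_self _ n.succ_ne_zero))).2 isCoprime_one_left
    refine ⟨m, (IsCoprime.pow_left_iff (Nat.sub_pos_of_lt hp.one_lt)).1 hcop, ?_⟩
    obtain ⟨k, hk⟩ := Nat.sub_one_dvd_pow_sub_one p n
    calc m = m * 1 ^ k := by rw [one_pow, mul_one]
      _ ≡ m * (m ^ (p - 1)) ^ k [ZMOD (p : ℤ) ^ (n + 1)] := (hm.symm.pow k).mul_left m
      _ = m ^ p ^ n := by
        rw [← pow_mul, ← hk, ← pow_succ', Nat.sub_add_cancel (Nat.one_le_pow _ _ hp.pos)]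

end Teichmuller

section DeterminantValues

variable {p n : ℕ} [Fact p.Prime]

theorem mem_groupDetValues_of_mem_teichmullerSet [Fintype G] [DecidableEq G]
    (hG : Nat.card G = p ^ (n + 1)) (hexp : ∀ c : A, c ^ p = 1) (hA : Nat.card A = p ^ n)
    {π : G →* A} (hπ : Function.Surjective π) {d : ℤ} (hd : d ∈ teichmullerSet p (n + 1)) :
    d ∈ groupDetValues G := by
  have hp := Fact.out (p := p.Prime)
  have : Finite A := .of_surjective π hπ
  obtain ⟨a, ha, hap, hda⟩ := hd
  have hcop : p.Coprime a := Nat.coprime_of_lt_prime (by omega) hap hp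
  have hker : Nat.card π.ker = p := by
    have hcard := card_ker_mul_card hπ
    rw [hA, hG, pow_succ'] at hcard
    exact Nat.eq_of_mul_eq_mul_right (pow_pos hp.pos n) hcard
  have hlift : (a : ℤ) ^ p ^ (n + 1) ∈ normAugmentationValues G := by
    rw [pow_succ, pow_mul]
    exact_mod_cast pow_prime_mem_normAugmentationValues hexp hπ hker (hcop.pow_right (p ^ n))
      (by exact_mod_cast pow_card_mem_normAugmentationValues hexp hA hcop)
  have hmod : d ≡ (a : ℤ) ^ p ^ (n + 1) [ZMOD Nat.card G] := by
    rw [hG, Nat.cast_pow, pow_succ' p n, pow_mul]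
    exact hda.trans (pow_pow_modEq (Int.ModEq.pow_prime_eq_self hp a).symm n)
  obtain ⟨x, hx, -⟩ := mem_normAugmentationValues_of_modEq hlift (by positivity) hmod
  exact mem_groupDetValues_iff.2 ⟨x, hx⟩

theorem norm_mem_teichmullerSet [Finite G] (hG : Nat.card G = p ^ (n + 1))
    (hexp : ∀ g : G, g ^ p = 1) {x : ℤ[G]} (hx : IsCoprime (Algebra.norm ℤ x) p) :
    Algebra.norm ℤ x ∈ teichmullerSet p (n + 1) := by
  have hp := Fact.out (p := p.Prime)
  have hmod := norm_modEq_augmentation_pow (k := 1) hG (by simpa using hexp) x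
  rw [pow_succ' p n, pow_mul] at hmod
  refine mem_teichmullerSet_succ_iff.2 ⟨augmentation x ^ p, ?_, hmod⟩
  have hcop := (isCoprime_iff_of_modEq (hmod.of_dvd (dvd_pow_self _ n.succ_ne_zero))).1 hx
  exact (IsCoprime.pow_left_iff (pow_pos hp.pos n)).1 hcop

theorem coprimeGroupDetValues_eq_teichmullerSet [Fintype G] [DecidableEq G]
    (hG : Nat.card G = p ^ (n + 1)) (hexp : ∀ g : G, g ^ p = 1) (hA : Nat.card A = p ^ n)
    {π : G →* A} (hπ : Function.Surjective π) :
    coprimeGroupDetValues p G = teichmullerSet p (n + 1) := by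
  have hexpA (c : A) : c ^ p = 1 := by
    obtain ⟨g, rfl⟩ := hπ c
    rw [← map_pow, hexp, map_one]
  ext d
  constructor
  · rintro ⟨hd, hdp⟩
    obtain ⟨x, rfl⟩ := mem_groupDetValues_iff.1 hd
    exact norm_mem_teichmullerSet hG hexp hdp
  · intro hd
    exact ⟨mem_groupDetValues_of_mem_teichmullerSet hG hexpA hA hπ hd,
      isCoprime_of_mem_teichmullerSet_succ hd⟩

end DeterminantValues

section Heisenberg

/-- The matrix `!![1, a, c; 0, 1, b; 0, 0, 1]` as an element of the Heisenberg group. -/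
def heisenbergMk (a b c : R) : heisenberg R :=
  ⟨⟨!![1, a, c; 0, 1, b; 0, 0, 1], !![1, -a, a * b - c; 0, 1, -b; 0, 0, 1],
      by simp [Matrix.one_fin_three], by simp [Matrix.one_fin_three, sub_eq_add_neg]⟩,
    a, b, c, rfl⟩

theorem exists_eq_heisenbergMk (g : heisenberg R) : ∃ a b c, g = heisenbergMk a b c := by
  obtain ⟨g, a, b, c, h⟩ := g
  exact ⟨a, b, c, Subtype.ext (Units.ext h)⟩

/-- The coordinates `(a, b, c)` of an element of the Heisenberg group. -/
def heisenbergEquiv (R : Type*) [CommRing R] : heisenberg R ≃ R × R × R where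
  toFun g := (g.1 0 1, g.1 1 2, g.1 0 2)
  invFun t := heisenbergMk t.1 t.2.1 t.2.2
  left_inv g := by
    obtain ⟨a, b, c, rfl⟩ := exists_eq_heisenbergMk g
    simp [heisenbergMk]
  right_inv t := by simp [heisenbergMk]

theorem natCard_heisenberg (R : Type*) [CommRing R] : Nat.card (heisenberg R) = Nat.card R ^ 3 := by
  rw [Nat.card_congr (heisenbergEquiv R), Nat.card_prod, Nat.card_prod]
  ring

theorem heisenberg_sub_one_pow_three (g : heisenberg R) :
    ((g : GL (Fin 3) R) - 1 : Matrix (Fin 3) (Fin 3) R) ^ 3 = 0 := by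
  obtain ⟨a, b, c, hg⟩ := g.2
  have hsub : (!![1, a, c; 0, 1, b; 0, 0, 1] - 1 : Matrix (Fin 3) (Fin 3) R) =
      !![0, a, c; 0, 0, b; 0, 0, 0] := by
    ext i j
    fin_cases i <;> fin_cases j <;> simp
  rw [hg, hsub]
  ext i j
  fin_cases i <;> fin_cases j <;> simp [pow_succ]

theorem heisenberg_pow_prime {p : ℕ} [Fact p.Prime] [CharP R p] (hp : 3 ≤ p) (g : heisenberg R) :
    g ^ p = 1 := by
  apply Subtype.ext
  apply Units.ext
  rw [SubgroupClass.coe_pow, Units.val_pow_eq_pow_val, OneMemClass.coe_one, Units.val_one,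
    ← sub_eq_zero]
  have hsub := sub_pow_char_of_commute p (Commute.one_right (g.1.1 : Matrix (Fin 3) (Fin 3) R))
  rw [one_pow] at hsub
  rw [← hsub]
  exact pow_eq_zero_of_le hp (heisenberg_sub_one_pow_three g)

/-- The projection `(a, b, c) ↦ (a, b)` of the Heisenberg group. -/
def heisenbergProj (R : Type*) [CommRing R] : heisenberg R →* Multiplicative (R × R) where
  toFun g := Multiplicative.ofAdd (g.1 0 1, g.1 1 2)
  map_one' := by simp
  map_mul' g h := by
    obtain ⟨a, b, c, rfl⟩ := exists_eq_heisenbergMk g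
    obtain ⟨a', b', c', rfl⟩ := exists_eq_heisenbergMk h
    rw [← ofAdd_add]
    simp [heisenbergMk, Matrix.mul_apply, Fin.sum_univ_three, add_comm]

theorem heisenbergProj_surjective : Function.Surjective (heisenbergProj R) := fun t =>
  ⟨heisenbergMk t.toAdd.1 t.toAdd.2 0, by simp [heisenbergProj, heisenbergMk]⟩

end Heisenberg

section Examples

variable {p : ℕ} [Fact p.Prime]

theorem coprimeGroupDetValues_heisenberg (hp : 3 ≤ p) :
    coprimeGroupDetValues p (heisenberg (ZMod p)) = teichmullerSet p 3 :=
  coprimeGroupDetValues_eq_teichmullerSet (n := 2) (by rw [natCard_heisenberg, Nat.card_zmod])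
    (heisenberg_pow_prime hp) (by simp [sq]) heisenbergProj_surjective

theorem coprimeGroupDetValues_elementaryAbelian (n : ℕ) :
    coprimeGroupDetValues p (Multiplicative (Fin (n + 1) → ZMod p)) =
      teichmullerSet p (n + 1) := by
  let π : (Fin (n + 1) → ZMod p) →+ (Fin n → ZMod p) :=
    (LinearMap.funLeft (ZMod p) (ZMod p) Fin.succ).toAddMonoidHom
  have hπ : Function.Surjective π.toMultiplicative :=
    LinearMap.funLeft_surjective_of_injective (ZMod p) (ZMod p) _ (Fin.succ_injective n)
  refine coprimeGroupDetValues_eq_teichmullerSet (by simp) (fun g => ?_) (by simp) hπ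
  rw [← ofAdd_toAdd g, ← ofAdd_nsmul]
  simp

end Examples

end GroupDeterminant

theorem corollary3p2 (p : ℕ) [Fact p.Prime] (hp : 3 ≤ p) :
    coprimeGroupDetValues p (heisenberg (ZMod p)) = teichmullerSet p 3 ∧
    teichmullerSet p 3 = {x : ℤ | x ^ (p - 1) ≡ 1 [ZMOD (p : ℤ) ^ 3]} ∧
    coprimeGroupDetValues p (Multiplicative (Fin 3 → ZMod p)) = teichmullerSet p 3 :=
  ⟨GroupDeterminant.coprimeGroupDetValues_heisenberg hp, GroupDeterminant.teichmullerSet_succ_eq,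
    GroupDeterminant.coprimeGroupDetValues_elementaryAbelian 2⟩
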